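/- Let $\mathcal X,\mathcal Z$ be real Hilbert spaces, $A:\mathcal X\to\mathcal Z$ a continuous linear operator, $b\in\mathcal Z$, $\mu_f\ge 0$, and let $f:\mathcal X\to\mathbb R\cup\{+\infty\}$ be proper, convex and lower semicontinuous with $$f(x_1)-f(x_2)-\langle w,x_1-x_2\rangle\ \ge\ \tfrac{\mu_f}{2}\|x_1-x_2\|^2\qquad\text{for all } x_1,x_2\in\mathcal X,\ w\in\partial f(x_2).$$ Consider the problem $\min_x f(x)$ subject to $Ax=b$, its Lagrangian $\mathcal L(x,\lambda)=f(x)+\langle\lambda,Ax-b\rangle$ and its augmented Lagrangian $\mathcal L_\theta(x,\lambda)=\mathcal L(x,\lambda)+\frac\theta2\|Ax-b\|^2$. Assume that $\mathcal L$ has a saddle point, that is, a pair $(x^*,\lambda^*)$ with $\mathcal L(x^*,\lambda)\le\mathcal L(x^*,\lambda^*)\le\mathcal L(x,\lambda^*)$ for all $(x,\lambda)\in\mathcal X\times\mathcal Z$. Let $\delta>0$, $\gamma>0$ and let $(\alpha_k)_{k\ge1}$, $(\beta_k)_{k\ge1}$, $(\epsilon_k)_{k\ge1}$ be real sequences. Starting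 from $x_1=x_0=\frac1\gamma Z_1$ and $\lambda_1=\lambda_0$, let the sequences $(x_k)$, $(Z_k)$, $(Z^\delta_k)$, $(\lambda_k)$ be generated for $k=1,2,\dots$ as follows: with $\theta_k=(\alpha_k+\delta)\beta_k$, $\eta_k=\gamma+\frac1{\alpha_k}+\mu_f\delta\beta_k$, $\widetilde\lambda_k=\lambda_k-\delta\beta_k(Ax_k-b)$ and $\widetilde x_k=x_k+\frac{Z_k-\gamma x_k}{\eta_k}$, $$x_{k+1}=\operatorname*{arg\,min}_{x\in\mathcal X}\Big(\mathcal L_{\theta_k}(x,\widetilde\lambda_k)+\frac{\eta_k}{2\alpha_k\beta_k}\|x-\widetilde x_k\|^2+\frac{\epsilon_k}{2}\|x\|^2\Big),$$ $$Z_{k+1}=\Big(\gamma+\frac1{\alpha_k}\Big)x_{k+1}-\frac1{\alpha_k}x_k,\qquad Z^\delta_{k+1}=\delta Z_{k+1}+(1-\delta\gamma)x_{k+1},\qquad \lambda_{k+1}=\lambda_k+\alpha_k\beta_k(AZ^\delta_{k+1}-b).$$ Assume that $\alpha_k>0$ for all $k\ge1$; that $(\beta_k)_{k\ge1}$ is positive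 and nondecreasing with $\beta_k\to+\infty$; that $\delta\gamma-1\ge0$ and $\delta\beta_{k+1}\le\delta\beta_k+\alpha_k\beta_k$ for all $k\ge1$; and that $(\epsilon_k)_{k\ge1}$ is nonincreasing with $\sum_{k=1}^{\infty}\alpha_k\epsilon_k<+\infty$ and $\beta_k\epsilon_k\to+\infty$. Then the problem has a unique solution $\bar x^*$ of minimal norm (the projection of $0$ onto the set of optimal solutions), and $$\liminf_{k\to+\infty}\|x_k-\bar x^*\|=0.$$ Further, if there is an integer $K\ge1$ such that the sequence $(x_k)_{k\ge K}$ stays in the open ball $B(0,\|\bar x^*\|)$ or stays in its complement, then $$\lim_{k\to+\infty}\|x_k-\bar x^*\|=0.$$ -/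

import Mathlib

open Filter Topology

namespace PrimalDual

noncomputable section

variable {X Z : Type*}
  [NormedAddCommGroup X] [InnerProductSpace ℝ X]
  [NormedAddCommGroup Z] [InnerProductSpace ℝ Z]

/-- `w` is a subgradient at `x` of the extended-real-valued function `f`. -/
def IsSubgradientAt (f : X → EReal) (x w : X) : Prop :=
  ∀ y, f x + ((inner ℝ w (y - x) : ℝ) : EReal) ≤ f y

/-- `f : X → ℝ ∪ {+∞}` is proper, lower semicontinuous and convex (its epigraph is convex), and
every subgradient inequality holds with the additional term `μ / 2 * ‖x₁ - x₂‖ ^ 2`.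
For `μ = 0` this is convexity alone, for `μ > 0` it is `μ`-strong convexity. -/
structure IsProperConvexLsc (f : X → EReal) (μ : ℝ) : Prop where
  ne_bot : ∀ x, f x ≠ ⊥
  exists_ne_top : ∃ x, f x ≠ ⊤
  lsc : LowerSemicontinuous f
  convex_epigraph : Convex ℝ {p : X × ℝ | f p.1 ≤ (p.2 : EReal)}
  subgradient_ineq : ∀ x₂ w, IsSubgradientAt f x₂ w → ∀ x₁,
    f x₂ + ((inner ℝ w (x₁ - x₂) + μ / 2 * ‖x₁ - x₂‖ ^ 2 : ℝ) : EReal) ≤ f x₁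

/-- The Lagrangian `f x + ⟪l, A x - b⟫` of the problem `min f x` subject to `A x = b`. -/
def lagrangian (f : X → EReal) (A : X →L[ℝ] Z) (b : Z) (x : X) (l : Z) : EReal :=
  f x + ((inner ℝ l (A x - b) : ℝ) : EReal)

/-- The augmented Lagrangian with penalty parameter `θ`. -/
def augLagrangian (f : X → EReal) (A : X →L[ℝ] Z) (b : Z) (θ : ℝ) (x : X) (l : Z) : EReal :=
  lagrangian f A b x l + ((θ / 2 * ‖A x - b‖ ^ 2 : ℝ) : EReal)

/-- `(xs, ls)` is a saddle point of the Lagrangian. -/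
def IsSaddlePoint (f : X → EReal) (A : X →L[ℝ] Z) (b : Z) (xs : X) (ls : Z) : Prop :=
  (∀ l, lagrangian f A b xs l ≤ lagrangian f A b xs ls) ∧
    ∀ x, lagrangian f A b xs ls ≤ lagrangian f A b x ls

/-- The set of optimal solutions of `min f x` subject to `A x = b`. -/
def solutionSet (f : X → EReal) (A : X →L[ℝ] Z) (b : Z) : Set X :=
  {x | A x = b ∧ ∀ y, A y = b → f x ≤ f y}

/-- `xbar` is an element of minimal norm of `S`, that is, a projection of `0` onto `S`. -/
def IsMinNormElement (S : Set X) (xbar : X) : Prop :=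
  xbar ∈ S ∧ ∀ x ∈ S, ‖xbar‖ ≤ ‖x‖

/-- The function minimized in iteration `k` of the algorithm, where `x`, `z`, `lam` are the
current iterates `x_k`, `Z_k`, `λ_k` and `α`, `β`, `ε` the current parameters
`α_k`, `β_k`, `ε_k`. -/
def subproblem (f : X → EReal) (A : X →L[ℝ] Z) (b : Z) (μ δ γ α β ε : ℝ)
    (x z : X) (lam : Z) (u : X) : EReal :=
  let θ : ℝ := (α + δ) * β
  let η : ℝ := γ + 1 / α + μ * δ * β
  let lamTilde : Z := lam - (δ * β) • (A x - b)
  let xTilde : X := x + (1 / η) • (z - γ • x)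
  augLagrangian f A b θ u lamTilde +
    ((η / (2 * α * β) * ‖u - xTilde‖ ^ 2 + ε / 2 * ‖u‖ ^ 2 : ℝ) : EReal)

/-- The sequences `x`, `z`, `zδ`, `lam` (standing for `x_k`, `Z_k`, `Z^δ_k`, `λ_k`) are generated by
the primal-dual algorithm with the parameters `δ`, `γ`, `μ` and `α_k`, `β_k`, `ε_k`. -/
structure IsGenerated (f : X → EReal) (A : X →L[ℝ] Z) (b : Z) (μ δ γ : ℝ) (α β ε : ℕ → ℝ)
    (x z zδ : ℕ → X) (lam : ℕ → Z) : Prop where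
  init_x : x 1 = x 0
  init_z : x 0 = (1 / γ) • z 1
  init_lam : lam 1 = lam 0
  step_x : ∀ k, 1 ≤ k → ∀ u,
    subproblem f A b μ δ γ (α k) (β k) (ε k) (x k) (z k) (lam k) (x (k + 1)) ≤
      subproblem f A b μ δ γ (α k) (β k) (ε k) (x k) (z k) (lam k) u
  step_z : ∀ k, 1 ≤ k → z (k + 1) = (γ + 1 / α k) • x (k + 1) - (1 / α k) • x k
  step_zδ : ∀ k, 1 ≤ k → zδ (k + 1) = δ • z (k + 1) + (1 - δ * γ) • x (k + 1)
  step_lam : ∀ k, 1 ≤ k → lam (k + 1) = lam k + (α k * β k) • (A (zδ (k + 1)) - b)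

end

end PrimalDual

/-! The proof is a Lyapunov analysis. Put v_k = Z_k - γ x_k, the discrete velocity. The energy is
δβ_k times the sum of the gap L(x_k, λ*) - min f and the Tikhonov term ε_k/2 (‖x_k‖² - ‖x̄*‖²), plus
a nonnegative quadratic form in (x_k - x̄*, v_k), plus ½‖λ_k - λ*‖². By `energy_step` it grows in
one step by at most a nonnegative multiple of ‖x̄*‖² - ‖x_{k+1}‖². This is used in two ways.

Summed, the errors contribute at most a multiple of ∑ β_j α_j ε_j, which is o(β_k) by Kronecker's
lemma. Hence the gap and, through the dual recursion, the residual A x_k - b tend to 0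
(`tendsto_gap_and_residual`), and the iterates eventually enter every set of nearly optimal, nearly
feasible points. By `tendsto_minNorm_of_antitone` they then converge strongly to x̄* along any
filter on which limsup ‖x_k‖ ≤ ‖x̄*‖.

If eventually ‖x_k‖ ≥ ‖x̄*‖, the energy is eventually nonincreasing, and β_k ε_k → ∞ forces this
limsup bound. Otherwise ‖x_k‖ < ‖x̄*‖ infinitely often, and the bound is trivial along those
indices. -/

namespace PrimalDual

/-! ### Minimal-norm points of decreasing closed convex sets -/

/-- The projection `p` of `0` onto a nonempty closed convex set. -/
theorem exists_norm_sub_sq_le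
    {X : Type*} [NormedAddCommGroup X] [InnerProductSpace ℝ X] [CompleteSpace X] {S : Set X}
    (hne : S.Nonempty) (hS : IsClosed S) (hc : Convex ℝ S) :
    ∃ p ∈ S, ∀ y ∈ S, ‖y - p‖ ^ 2 ≤ ‖y‖ ^ 2 - ‖p‖ ^ 2 := by
  obtain ⟨p, hp, hpe⟩ := exists_norm_eq_iInf_of_complete_convex hne hS.isComplete hc 0
  refine ⟨p, hp, fun y hy => ?_⟩
  have h := (norm_eq_iInf_iff_real_inner_le_zero hc hp).1 hpe y hy
  have h2 : ‖y‖ ^ 2 = ‖p‖ ^ 2 + 2 * inner ℝ p (y - p) + ‖y - p‖ ^ 2 := by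
    rw [← norm_add_sq_real]; congr 2; abel
  rw [zero_sub, inner_neg_left] at h
  linarith

/-- A sequence that eventually enters each of a decreasing sequence of closed convex sets, and
whose norms are asymptotically at most the minimal norm of a point of the intersection, converges
strongly to the point of minimal norm. -/
theorem tendsto_minNorm_of_antitone
    {X ι : Type*} [NormedAddCommGroup X] [InnerProductSpace ℝ X] [CompleteSpace X]
    {D : ℕ → Set X} (hD : Antitone D) (hclosed : ∀ n, IsClosed (D n))
    (hconv : ∀ n, Convex ℝ (D n)) {xbar : X}
    (hmin : IsMinNormElement (⋂ n, D n) xbar) {l : Filter ι} {x : ι → X}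
    (hx : ∀ n, ∀ᶠ i in l, x i ∈ D n)
    (hnorm : ∀ r > ‖xbar‖ ^ 2, ∀ᶠ i in l, ‖x i‖ ^ 2 ≤ r) :
    Tendsto x l (𝓝 xbar) := by
  have hbar : ∀ n, xbar ∈ D n := fun n => Set.mem_iInter.1 hmin.1 n
  choose p hpD hpy using fun n => exists_norm_sub_sq_le ⟨xbar, hbar n⟩ (hclosed n) (hconv n)
  have hmono : Monotone fun n => ‖p n‖ ^ 2 := by
    intro n m hnm
    have := hpy n (p m) (hD hnm (hpD m))
    have := sq_nonneg ‖p m - p n‖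
    simp only
    linarith
  have hbdd : BddAbove (Set.range fun n => ‖p n‖ ^ 2) := by
    refine ⟨‖xbar‖ ^ 2, ?_⟩
    rintro _ ⟨n, rfl⟩
    have := hpy n xbar (hbar n)
    have := sq_nonneg ‖xbar - p n‖
    simp only
    linarith
  have hlim := tendsto_atTop_ciSup hmono hbdd
  set s : ℝ := ⨆ n, ‖p n‖ ^ 2 with hs
  have hps : ∀ n, ‖p n‖ ^ 2 ≤ s := fun n => le_ciSup hbdd n
  -- For N ≤ n, ‖p n - p N‖² ≤ ‖p n‖² - ‖p N‖², and the squared norms increase to `s`. Strong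
  -- convergence thus needs no weak compactness.
  have hcauchy : CauchySeq p := by
    rw [Metric.cauchySeq_iff']
    intro e he
    obtain ⟨N, hN⟩ := (hlim.eventually (lt_mem_nhds (show s - e ^ 2 < s by nlinarith))).exists
    refine ⟨N, fun n hn => ?_⟩
    have h1 := hpy N (p n) (hD hn (hpD n))
    rw [dist_eq_norm]
    refine lt_of_pow_lt_pow_left₀ 2 he.le ?_
    have := hps n
    linarith
  obtain ⟨q, hq⟩ := cauchySeq_tendsto_of_complete hcauchy
  have hqD : q ∈ ⋂ n, D n := by
    refine Set.mem_iInter.2 fun n => (hclosed n).mem_of_tendsto hq ?_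
    filter_upwards [eventually_ge_atTop n] with m hm using hD hm (hpD m)
  have hsq : s = ‖q‖ ^ 2 := tendsto_nhds_unique hlim (hq.norm.pow 2)
  have hle : ‖xbar‖ ^ 2 ≤ s := by
    rw [hsq]
    exact pow_le_pow_left₀ (norm_nonneg _) (hmin.2 q hqD) 2
  rw [Metric.tendsto_nhds]
  intro e he
  -- Since ‖xbar‖² ≤ s, the margins give ‖x i - p N‖² < e²/16 + e²/8 < (e/2)² and ‖xbar - p N‖² <
  -- e²/8 < (e/2)².
  obtain ⟨N, hN⟩ := (hlim.eventually
    (lt_mem_nhds (show s - e ^ 2 / 8 < s by nlinarith [sq_pos_of_pos he]))).exists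
  have he2 := sq_pos_of_pos he
  filter_upwards [hx N, hnorm (‖xbar‖ ^ 2 + e ^ 2 / 16) (by linarith)] with i hi hi2
  have h1 := hpy N (x i) hi
  have h2 := hpy N xbar (hbar N)
  have h3 : ‖x i - p N‖ < e / 2 := by
    refine lt_of_pow_lt_pow_left₀ 2 (by positivity) ?_
    nlinarith
  have h4 : ‖xbar - p N‖ < e / 2 := by
    refine lt_of_pow_lt_pow_left₀ 2 (by positivity) ?_
    nlinarith
  rw [dist_eq_norm]
  calc ‖x i - xbar‖ = ‖(x i - p N) - (xbar - p N)‖ := by congr 1; abel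
    _ ≤ ‖x i - p N‖ + ‖xbar - p N‖ := norm_sub_le _ _
    _ < e := by linarith

/-! ### The one-step energy inequality -/

variable {X Z : Type*}
  [NormedAddCommGroup X] [InnerProductSpace ℝ X]
  [NormedAddCommGroup Z] [InnerProductSpace ℝ Z]

/-- δ times the form equals ½‖y + δv‖² + ½(δγ - 1)‖y‖². It serves both for the energy itself and for
the remainder in `energy_step`. -/
theorem quadratic_form_nonneg {δ γ : ℝ} (hδ : 0 < δ) (hδγ : 0 ≤ δ * γ - 1) (y v : X) :
    0 ≤ γ / 2 * ‖y‖ ^ 2 + inner ℝ v y + δ / 2 * ‖v‖ ^ 2 := by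
  have hsq := sq_nonneg ‖y + δ • v‖
  rw [norm_add_sq_real, norm_smul, inner_smul_right, mul_pow, Real.norm_eq_abs, sq_abs,
    real_inner_comm] at hsq
  have h2 : 0 ≤ (δ * γ - 1) * ‖y‖ ^ 2 := by positivity
  refine nonneg_of_mul_nonneg_right (a := δ) ?_ hδ
  nlinarith

/-- One step of the algorithm decreases the Lyapunov function up to a Tikhonov error. -/
theorem energy_step [CompleteSpace X] [CompleteSpace Z] (A : X →L[ℝ] Z) (b : Z)
    {x₀ x₁ v₀ v₁ w xb : X} {l₀ l₁ ls : Z} {F₀ F₁ m α β β' ε ε' δ γ μ : ℝ}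
    (hα : 0 < α) (hβ : 0 < β) (hε : 0 ≤ ε) (hδ : 0 < δ) (hδγ : 0 ≤ δ * γ - 1) (hμ : 0 ≤ μ)
    (hβ' : δ * β' ≤ δ * β + α * β)
    (hx : x₀ = x₁ - α • v₁)
    (hl : l₁ = l₀ + (α * β) • (A (x₁ + δ • v₁) - b))
    (hopt : γ • α • v₁ + v₁ - v₀ + (μ * δ * β) • α • v₁ =
      -((α * β) • (w + A.adjoint l₁ + ε • x₁)))
    (hxb : A xb = b)
    (h1 : F₁ + inner ℝ w (xb - x₁) + μ / 2 * ‖xb - x₁‖ ^ 2 ≤ m)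
    (h0 : F₁ + inner ℝ w (x₀ - x₁) + μ / 2 * ‖x₀ - x₁‖ ^ 2 ≤ F₀)
    (hG : m ≤ F₁ + inner ℝ ls (A x₁ - b)) :
    δ * β' * (F₁ + inner ℝ ls (A x₁ - b) - m + ε' / 2 * (‖x₁‖ ^ 2 - ‖xb‖ ^ 2))
      + (γ / 2 * ‖x₁ - xb‖ ^ 2 + inner ℝ v₁ (x₁ - xb) + δ / 2 * ‖v₁‖ ^ 2)
      + μ * δ * β' / 2 * ‖x₁ - xb‖ ^ 2 + 1 / 2 * ‖l₁ - ls‖ ^ 2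
    ≤ δ * β * (F₀ + inner ℝ ls (A x₀ - b) - m + ε / 2 * (‖x₀‖ ^ 2 - ‖xb‖ ^ 2))
      + (γ / 2 * ‖x₀ - xb‖ ^ 2 + inner ℝ v₀ (x₀ - xb) + δ / 2 * ‖v₀‖ ^ 2)
      + μ * δ * β / 2 * ‖x₀ - xb‖ ^ 2 + 1 / 2 * ‖l₀ - ls‖ ^ 2
      - (ε * β * (α + δ) - δ * β' * ε') / 2 * (‖x₁‖ ^ 2 - ‖xb‖ ^ 2) := by
  obtain ⟨y, rfl⟩ : ∃ y, x₁ = y + xb := ⟨x₁ - xb, by abel⟩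
  have e1 : y + xb - xb = y := by abel
  have e2 : xb - (y + xb) = -y := by abel
  have e3 : x₀ - (y + xb) = -(α • v₁) := by rw [hx]; abel
  have e4 : x₀ - xb = y - α • v₁ := by rw [hx]; abel
  have e5 : A (y + xb) - b = A y := by rw [map_add, hxb]; abel
  have e6 : A x₀ - b = A y - α • A v₁ := by
    rw [hx, map_sub, map_add, hxb, map_smul]; abel
  have e7 : A (y + xb + δ • v₁) - b = A y + δ • A v₁ := by
    rw [map_add, map_add, hxb, map_smul]; abel
  rw [e7] at hl
  -- The test vector (x₁ - xb) + δ v₁ is the one whose image under `A` is the direction of the dual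
  -- update, so the multiplier term becomes a difference of squared distances to `ls`.
  have hoptd := congrArg (fun u => inner ℝ u (y + δ • v₁)) hopt
  have hl0 : l₀ - ls = (l₁ - ls) - (α * β) • (A y + δ • A v₁) := by rw [hl]; abel
  have hl1 : inner ℝ l₁ (A y + δ • A v₁) =
      inner ℝ (l₁ - ls) (A y + δ • A v₁) + inner ℝ ls (A y + δ • A v₁) := by
    rw [← inner_add_left]; congr 1; abel
  have hlq : ‖l₁ - ls‖ ^ 2 - ‖l₀ - ls‖ ^ 2 ≤
      2 * (α * β) * inner ℝ (l₁ - ls) (A y + δ • A v₁) := by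
    rw [hl0, norm_sub_sq_real (l₁ - ls), inner_smul_right]
    nlinarith [sq_nonneg ‖(α * β) • (A y + δ • A v₁)‖]
  simp only [inner_add_left, inner_sub_left, inner_neg_left, inner_smul_left,
    RCLike.conj_to_real, ContinuousLinearMap.adjoint_inner_left, map_add, map_smul] at hoptd
  rw [hl1] at hoptd
  rw [e1, e4, e5, e6, hx]
  rw [e2] at h1
  rw [e3] at h0
  rw [e5] at hG
  -- Subtracting the left side of the tested optimality condition, without its μ term, from the
  -- change of the quadratic part of the energy leaves minus this form and -(δγ - 1)α‖v₁‖².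
  have hq : 0 ≤ γ / 2 * α ^ 2 * ‖v₁‖ ^ 2 + α * inner ℝ v₁ (v₁ - v₀) + δ / 2 * ‖v₁ - v₀‖ ^ 2 := by
    have := quadratic_form_nonneg hδ hδγ (α • v₁) (v₁ - v₀)
    rw [norm_smul, inner_smul_right, mul_pow, Real.norm_eq_abs, sq_abs,
      real_inner_comm] at this
    linarith
  simp only [← real_inner_self_eq_norm_sq] at *
  simp only [inner_add_left, inner_sub_left, inner_neg_left, inner_smul_left,
    inner_add_right, inner_sub_right, inner_neg_right, inner_smul_right,
    RCLike.conj_to_real, real_inner_comm y v₁, real_inner_comm xb v₁, real_inner_comm v₁ v₀,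
    real_inner_comm y v₀, real_inner_comm xb y] at *
  have nyy : 0 ≤ inner ℝ y y := real_inner_self_nonneg
  have nvv : 0 ≤ inner ℝ v₁ v₁ := real_inner_self_nonneg
  -- The weights αβ and δβ match the coefficients of ⟪w, x₁ - xb⟫ and ⟪w, α v₁⟫ in the tested
  -- condition. They put weight δβ + αβ on the new gap; the excess over δβ' is nonnegative and is
  -- dropped.
  have k1 := mul_le_mul_of_nonneg_left h1 (mul_pos hα hβ).le
  have k0 := mul_le_mul_of_nonneg_left h0 (mul_pos hδ hβ).le
  have kG := mul_le_mul_of_nonneg_left hG (sub_nonneg.2 hβ')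
  have kμ := mul_nonneg (mul_nonneg (sub_nonneg.2 hβ') hμ) nyy
  have kε : 0 ≤ α * β * ε * inner ℝ y y := by positivity
  have kε' : 0 ≤ δ * β * ε * α ^ 2 * inner ℝ v₁ v₁ := by positivity
  have kμ' : 0 ≤ δ * β * μ * α ^ 2 * inner ℝ v₁ v₁ := by positivity
  have kμ'' : 0 ≤ δ * β * μ * α * δ * inner ℝ v₁ v₁ := by positivity
  have kv : 0 ≤ (δ * γ - 1) * α * inner ℝ v₁ v₁ := by positivity
  ring_nf at *
  linarith

/-! ### Optimality condition of the subproblem -/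

theorem exists_coe_eq {f : X → EReal} {μ : ℝ} (hf : IsProperConvexLsc f μ) {x : X}
    (hx : f x ≠ ⊤) : ∃ r : ℝ, f x = r :=
  ⟨(f x).toReal, (EReal.coe_toReal hx (hf.ne_bot x)).symm⟩

theorem convex_sublevel {f : X → EReal} {μ : ℝ} (hf : IsProperConvexLsc f μ) (r : ℝ) :
    Convex ℝ {x | f x ≤ (r : EReal)} := by
  intro x hx y hy s t hs ht hst
  have := hf.convex_epigraph (show (x, r) ∈ {p : X × ℝ | f p.1 ≤ (p.2 : EReal)} from hx)
    (show (y, r) ∈ {p : X × ℝ | f p.1 ≤ (p.2 : EReal)} from hy) hs ht hst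
  simp only [Set.mem_ofPred_eq, Prod.fst_add, Prod.smul_fst, Prod.snd_add, Prod.smul_snd,
    smul_eq_mul, ← add_mul, hst, one_mul] at this
  exact this

/-- If `F` has a quadratic expansion around a minimizer `x` of `f + F`, then minus the gradient of
`F` is a subgradient of `f`. -/
theorem isSubgradientAt_of_minimizer {f : X → EReal} {μ : ℝ} (hf : IsProperConvexLsc f μ)
    {x g : X} {F : X → ℝ} (hfx : f x ≠ ⊤)
    (hF : ∀ d, ∃ R : ℝ, ∀ t : ℝ, F (x + t • d) = F x + t * inner ℝ g d + t ^ 2 * R)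
    (hmin : ∀ u, f x + (F x : EReal) ≤ f u + (F u : EReal)) :
    IsSubgradientAt f x (-g) := by
  intro y
  obtain ⟨p, hp⟩ := exists_coe_eq hf hfx
  by_cases hy : f y = ⊤
  · rw [hy]; exact le_top
  obtain ⟨q, hq⟩ := exists_coe_eq hf hy
  obtain ⟨R, hR⟩ := hF (y - x)
  -- Minimality is tested on the segment from `x` to `y`; after division by `t` the quadratic
  -- remainder is t R, which vanishes as t → 0.
  have key : ∀ t : ℝ, 0 < t → t ≤ 1 → p - q ≤ inner ℝ g (y - x) + t * R := by
    intro t ht ht1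
    have hc := hf.convex_epigraph (show (x, p) ∈ {p : X × ℝ | f p.1 ≤ (p.2 : EReal)} from hp.le)
      (show (y, q) ∈ {p : X × ℝ | f p.1 ≤ (p.2 : EReal)} from hq.le)
      (sub_nonneg.2 ht1) ht.le (by ring)
    simp only [Set.mem_ofPred_eq, Prod.fst_add, Prod.smul_fst, Prod.snd_add, Prod.smul_snd,
      smul_eq_mul] at hc
    have hpt : (1 - t) • x + t • y = x + t • (y - x) := by
      rw [sub_smul, one_smul, smul_sub]; abel
    rw [hpt] at hc
    have h := (hmin (x + t • (y - x))).trans (add_le_add_left hc _)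
    rw [hp, hR t] at h
    have h' : p + F x ≤ (1 - t) * p + t * q + (F x + t * inner ℝ g (y - x) + t ^ 2 * R) := by
      exact_mod_cast h
    refine le_of_mul_le_mul_left ?_ ht
    linarith
  have hlim : Tendsto (fun t : ℝ => inner ℝ g (y - x) + t * R) (𝓝[>] 0)
      (𝓝 (inner ℝ g (y - x) + 0 * R)) :=
    ((continuous_const.add (continuous_id.mul continuous_const)).tendsto _).mono_left
      nhdsWithin_le_nhds
  have hle : p - q ≤ inner ℝ g (y - x) + 0 * R := by
    refine ge_of_tendsto hlim ?_
    filter_upwards [Ioc_mem_nhdsGT (zero_lt_one' ℝ)] with t ht using key t ht.1 ht.2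
  rw [hp, hq, inner_neg_left]
  have : p + -inner ℝ g (y - x) ≤ q := by linarith
  exact_mod_cast this

/-- The smooth part of the subproblem has a quadratic expansion. -/
theorem smooth_part_expansion [CompleteSpace X] [CompleteSpace Z] (A : X →L[ℝ] Z) (b l : Z)
    (θ c ε : ℝ) (xt x d : X) : ∃ R : ℝ, ∀ t : ℝ,
    (inner ℝ l (A (x + t • d) - b) + θ / 2 * ‖A (x + t • d) - b‖ ^ 2 +
      (c * ‖x + t • d - xt‖ ^ 2 + ε / 2 * ‖x + t • d‖ ^ 2) : ℝ) =
    (inner ℝ l (A x - b) + θ / 2 * ‖A x - b‖ ^ 2 + (c * ‖x - xt‖ ^ 2 + ε / 2 * ‖x‖ ^ 2)) +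
      t * inner ℝ (A.adjoint (l + θ • (A x - b)) + (2 * c) • (x - xt) + ε • x) d +
      t ^ 2 * R := by
  refine ⟨θ / 2 * ‖A d‖ ^ 2 + c * ‖d‖ ^ 2 + ε / 2 * ‖d‖ ^ 2, fun t => ?_⟩
  have e1 : A (x + t • d) - b = (A x - b) + t • A d := by rw [map_add, map_smul]; abel
  have e2 : x + t • d - xt = (x - xt) + t • d := by abel
  rw [e1, e2, norm_add_sq_real (A x - b), norm_add_sq_real (x - xt), norm_add_sq_real x]
  simp only [norm_smul, inner_add_left, inner_add_right, inner_smul_left, inner_smul_right,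
    RCLike.conj_to_real, ContinuousLinearMap.adjoint_inner_left, mul_pow, Real.norm_eq_abs, sq_abs]
  ring

/-- The iterates of the algorithm satisfy the first-order optimality condition. -/
theorem exists_subgradient_of_subproblem_minimizer [CompleteSpace X] [CompleteSpace Z]
    {f : X → EReal} {A : X →L[ℝ] Z} {b : Z} {μ δ γ α β ε : ℝ} {x x' z z' : X} {lam lam' : Z}
    (hf : IsProperConvexLsc f μ) (hα : 0 < α) (hβ : 0 < β) (hγ : 0 < γ) (hδ : 0 < δ)
    (hμ : 0 ≤ μ)
    (hmin : ∀ u, subproblem f A b μ δ γ α β ε x z lam x' ≤ subproblem f A b μ δ γ α β ε x z lam u)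
    (hz : z' = (γ + 1 / α) • x' - (1 / α) • x)
    (hlam : lam' = lam + (α * β) • (A (δ • z' + (1 - δ * γ) • x') - b)) :
    f x' ≠ ⊤ ∧ ∃ w, IsSubgradientAt f x' w ∧
      z' - z + (μ * δ * β) • (x' - x) = -((α * β) • (w + A.adjoint lam' + ε • x')) := by
  set η : ℝ := γ + 1 / α + μ * δ * β with hη
  have hη0 : 0 < η := by positivity
  set θ : ℝ := (α + δ) * β with hθ
  set l : Z := lam - (δ * β) • (A x - b) with hl
  set xt : X := x + (1 / η) • (z - γ • x) with hxt
  set c : ℝ := η / (2 * α * β) with hc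
  let F : X → ℝ := fun u => inner ℝ l (A u - b) + θ / 2 * ‖A u - b‖ ^ 2 +
    (c * ‖u - xt‖ ^ 2 + ε / 2 * ‖u‖ ^ 2)
  have hsub : ∀ u, subproblem f A b μ δ γ α β ε x z lam u = f u + (F u : EReal) := by
    intro u
    change f u + ((inner ℝ l (A u - b) : ℝ) : EReal) + ((θ / 2 * ‖A u - b‖ ^ 2 : ℝ) : EReal) +
      ((c * ‖u - xt‖ ^ 2 + ε / 2 * ‖u‖ ^ 2 : ℝ) : EReal) = _
    simp only [F, EReal.coe_add, add_assoc]
  simp only [hsub] at hmin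
  have hfx : f x' ≠ ⊤ := by
    intro htop
    obtain ⟨u, hu⟩ := hf.exists_ne_top
    obtain ⟨r, hr⟩ := exists_coe_eq hf hu
    have h := hmin u
    rw [htop, hr, EReal.top_add_coe, ← EReal.coe_add, top_le_iff] at h
    exact EReal.coe_ne_top _ h
  refine ⟨hfx, _, isSubgradientAt_of_minimizer hf hfx
    (smooth_part_expansion A b l θ c ε xt x') hmin, ?_⟩
  -- Because δ z' + (1 - δγ) x' = x' + (δ/α)(x' - x), the extrapolated multiplier plus the penalty
  -- gradient is exactly the new multiplier: the scheme is implicit in the dual variable.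
  have hlam' : lam' = l + θ • (A x' - b) := by
    have : A (δ • z' + (1 - δ * γ) • x') - b = (A x' - b) + (δ / α) • (A x' - A x) := by
      rw [sub_add_eq_add_sub, ← map_sub, ← map_smul, ← map_add, hz]
      congr 1
      congr 1
      module
    rw [hlam, this, hl, hθ]
    have h1 : α * β * (δ / α) = δ * β := by field_simp
    rw [smul_add, smul_smul, h1]
    module
  -- Scaling by αβ turns the proximal weight into η, and the centre `xt` is such that the result is
  -- an increment of `z` plus the strong convexity correction.
  have hzx : (α * β * (2 * c)) • (x' - xt) = z' - z + (μ * δ * β) • (x' - x) := by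
    have h1 : α * β * (2 * c) = η := by rw [hc]; field_simp
    have h2 : η • xt = η • x + (z - γ • x) := by
      rw [hxt, smul_add, smul_smul, mul_one_div_cancel hη0.ne', one_smul]
    rw [h1, smul_sub, h2, hz, hη]
    module
  rw [← hzx, ← hlam']
  module

/-! ### Weighted sums and the dual recursion -/

/-- Kronecker's lemma for nonnegative series. -/
theorem tendsto_weighted_sum_div {a β : ℕ → ℝ} (ha : ∀ k, 0 ≤ a k) (hsum : Summable a)
    (hβ : ∀ k, 0 < β k) (hmono : Monotone β) (hlim : Tendsto β atTop atTop) :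
    Tendsto (fun k => (∑ j ∈ Finset.range k, β j * a j) / β k) atTop (𝓝 0) := by
  -- For fixed j the term β_j a_j / β_k tends to 0, and for j < k it is at most a_j, so dominated
  -- convergence applies without summation by parts.
  have h := tendsto_tsum_of_dominated_convergence (𝓕 := atTop)
    (f := fun k j => if j < k then β j * a j / β k else 0) (g := fun _ => (0 : ℝ)) hsum ?_ ?_
  · simp only [tsum_zero] at h
    refine h.congr fun k => ?_
    rw [tsum_eq_sum (s := Finset.range k) (fun j hj => if_neg (by simpa using hj)),
      Finset.sum_div]
    exact Finset.sum_congr rfl fun j hj => if_pos (Finset.mem_range.1 hj)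
  · intro j
    refine (hlim.const_div_atTop (β j * a j)).congr' ?_
    filter_upwards [eventually_gt_atTop j] with k hk using (if_pos hk).symm
  · refine Eventually.of_forall fun k j => ?_
    split_ifs with hjk
    · rw [Real.norm_of_nonneg (div_nonneg (mul_nonneg (hβ j).le (ha j)) (hβ k).le),
        div_le_iff₀ (hβ k), mul_comm]
      exact mul_le_mul_of_nonneg_left (hmono hjk.le) (ha j)
    · simpa using ha j

/-- A bound on the scaled residuals `c k • r k` in terms of a monotone bound on the multipliers. -/
theorem norm_residual_le {Z : Type*} [NormedAddCommGroup Z] [NormedSpace ℝ Z]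
    {p r : ℕ → Z} {c a R : ℕ → ℝ} (hc : ∀ k, 0 < c k) (ha : ∀ k, 0 ≤ a k)
    (hrec : ∀ k, p (k + 1) - p k = c (k + 1) • r (k + 1) - c k • r k + a k • r (k + 1))
    (hR : Monotone R) (hp : ∀ k, ‖p k‖ ≤ R k) (h0 : ‖p 0 - c 0 • r 0‖ ≤ R 0) (k : ℕ) :
    ‖c k • r k‖ ≤ 2 * R k := by
  -- With S_k = p_k - c_k r_k and τ = a_k / c_{k+1} the recursion reads (1 + τ) S_{k+1} = S_k + τ
  -- p_{k+1}: a convex combination, so the ball of radius R_{k+1} is not left.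
  have hS : ∀ k, ‖p k - c k • r k‖ ≤ R k := by
    intro k
    induction k with
    | zero => exact h0
    | succ k ih =>
      set S := p (k + 1) - c (k + 1) • r (k + 1) with hSdef
      set τ := a k / c (k + 1) with hτ
      have hτ0 : 0 ≤ τ := div_nonneg (ha k) (hc _).le
      have h1 : τ • c (k + 1) • r (k + 1) = a k • r (k + 1) := by
        rw [smul_smul, hτ, div_mul_cancel₀ _ (hc _).ne']
      have h2 : (1 + τ) • S = (p k - c k • r k) + τ • p (k + 1) := by
        have h3 : p (k + 1) = p k + (c (k + 1) • r (k + 1) - c k • r k + a k • r (k + 1)) := by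
          rw [← hrec k]; abel
        have h4 : S = (p k - c k • r k) + a k • r (k + 1) := by
          rw [hSdef, h3]; abel
        have h5 : τ • S = τ • p (k + 1) - a k • r (k + 1) := by
          rw [hSdef, smul_sub, h1]
        rw [add_smul, one_smul, h5, h4]; abel
      have h6 := norm_add_le (p k - c k • r k) (τ • p (k + 1))
      rw [← h2, norm_smul, norm_smul, Real.norm_of_nonneg hτ0,
        Real.norm_of_nonneg (by linarith)] at h6
      have h7 := mul_le_mul_of_nonneg_left (hp (k + 1)) hτ0
      have h8 := hR k.le_succ
      simp only [Nat.succ_eq_add_one] at h8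
      refine le_of_mul_le_mul_left ?_ (show 0 < 1 + τ by linarith)
      linarith
  calc ‖c k • r k‖ = ‖p k - (p k - c k • r k)‖ := by congr 1; abel
    _ ≤ ‖p k‖ + ‖p k - c k • r k‖ := norm_sub_le _ _
    _ ≤ 2 * R k := by linarith [hp k, hS k]

/-! ### Scalar consequences of the energy inequality -/

section Scalar

variable {α β ε G N W P : ℕ → ℝ} {n δ : ℝ}

/-- The energy estimate summed over the iterations. -/
theorem energy_le_sum (hδ : 0 < δ) (hβ : ∀ k, 0 < β k) (hε : ∀ k, 0 ≤ ε k)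
    (hN : ∀ k, 0 ≤ N k) (hW : ∀ k, 0 ≤ W k)
    (hc : ∀ k, 0 ≤ ε k * β k * (α k + δ) - δ * β (k + 1) * ε (k + 1))
    (hstep : ∀ k, δ * β (k + 1) * (G (k + 1) + ε (k + 1) / 2 * (N (k + 1) - n)) + W (k + 1)
        + 1 / 2 * P (k + 1) ≤
      δ * β k * (G k + ε k / 2 * (N k - n)) + W k + 1 / 2 * P k
        - (ε k * β k * (α k + δ) - δ * β (k + 1) * ε (k + 1)) / 2 * (N (k + 1) - n)) (k : ℕ) :
    δ * β k * G k + 1 / 2 * P k ≤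
      δ * β 0 * (G 0 + ε 0 / 2 * N 0) + W 0 + 1 / 2 * P 0 +
        n / 2 * ∑ j ∈ Finset.range k, β j * (α j * ε j) := by
  -- The energy is taken without its `n` part: the terms δ β_k ε_k n/2 telescope against the error,
  -- leaving only (n/2) β_k α_k ε_k per step.
  have h : δ * β k * (G k + ε k / 2 * N k) + W k + 1 / 2 * P k ≤
      δ * β 0 * (G 0 + ε 0 / 2 * N 0) + W 0 + 1 / 2 * P 0 +
        n / 2 * ∑ j ∈ Finset.range k, β j * (α j * ε j) := by
    induction k with
    | zero => simp
    | succ k ih =>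
      rw [Finset.sum_range_succ]
      have h1 := mul_nonneg (hc k) (hN (k + 1))
      have h2 := hstep k
      linarith
  have h1 : 0 ≤ δ * β k * (ε k / 2 * N k) := by
    have := hβ k; have := hε k; have := hN k; positivity
  linarith [hW k]

/-- If the squared norms eventually dominate `n`, the energy is eventually nonincreasing, which
forces the squared norms to converge to `n`. -/
theorem eventually_le_of_eventually_ge (hδ : 0 < δ) (hβ : ∀ k, 0 < β k)
    (hβε : Tendsto (fun k => β k * ε k) atTop atTop)
    (hG : ∀ k, 0 ≤ G k) (hW : ∀ k, 0 ≤ W k) (hP : ∀ k, 0 ≤ P k)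
    (hc : ∀ k, 0 ≤ ε k * β k * (α k + δ) - δ * β (k + 1) * ε (k + 1))
    (hstep : ∀ k, δ * β (k + 1) * (G (k + 1) + ε (k + 1) / 2 * (N (k + 1) - n)) + W (k + 1)
        + 1 / 2 * P (k + 1) ≤
      δ * β k * (G k + ε k / 2 * (N k - n)) + W k + 1 / 2 * P k
        - (ε k * β k * (α k + δ) - δ * β (k + 1) * ε (k + 1)) / 2 * (N (k + 1) - n))
    (hge : ∀ᶠ k in atTop, n ≤ N k) {r : ℝ} (hr : n < r) : ∀ᶠ k in atTop, N k ≤ r := by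
  obtain ⟨K, hK⟩ := eventually_atTop.1 hge
  set E : ℕ → ℝ := fun k => δ * β k * (G k + ε k / 2 * (N k - n)) + W k + 1 / 2 * P k with hE
  have hEK : ∀ k, K ≤ k → E k ≤ E K := by
    intro k hk
    induction k, hk using Nat.le_induction with
    | base => exact le_rfl
    | succ k hk ih =>
      refine le_trans ?_ ih
      have h1 := mul_nonneg (hc k) (sub_nonneg.2 (hK (k + 1) (by omega)))
      have h2 := hstep k
      simp only [hE]
      linarith
  -- If N k > r, then δ β_k ε_k (r - n) < 2|E K|, which the threshold excludes; its +1 also forces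
  -- β_k ε_k > 0 when E K = 0.
  filter_upwards [eventually_ge_atTop K,
    hβε.eventually_ge_atTop (2 * (|E K| + 1) / (δ * (r - n)))] with k hk hk2
  have hrn : 0 < δ * (r - n) := mul_pos hδ (sub_pos.2 hr)
  rw [div_le_iff₀ hrn] at hk2
  have h1 := hEK k hk
  have h2 := mul_nonneg (mul_pos hδ (hβ k)).le (hG k)
  have h3 := hW k
  have h4 := hP k
  have h5 : δ * β k * (ε k / 2 * (N k - n)) ≤ |E K| := by
    refine le_trans ?_ (le_abs_self _)
    simp only [hE] at h1 ⊢
    linarith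
  by_contra hcon
  push Not at hcon
  have h6 : 0 < β k * ε k := by
    by_contra h
    have := abs_nonneg (E K)
    have := mul_nonneg (sub_nonneg.2 (not_lt.1 h)) hrn.le
    linarith
  have h7 := mul_lt_mul_of_pos_left hcon (mul_pos h6 hδ)
  have := abs_nonneg (E K)
  linarith

end Scalar

/-! ### Vanishing gap and residual -/

/-- The quantities produced by the energy estimate: the primal-dual gap and the feasibility
residual vanish. -/
theorem tendsto_gap_and_residual {A : X →L[ℝ] Z} {b ls : Z} {x v : ℕ → X} {l : ℕ → Z}
    {α β ε G N W : ℕ → ℝ} {n δ : ℝ}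
    (hδ : 0 < δ) (hα : ∀ k, 0 < α k) (hβ : ∀ k, 0 < β k) (hε : ∀ k, 0 ≤ ε k)
    (hmono : Monotone β) (hlim : Tendsto β atTop atTop)
    (hgrowth : ∀ k, δ * β (k + 1) ≤ δ * β k + α k * β k)
    (hsum : Summable fun k => α k * ε k)
    (hn : 0 ≤ n) (hG : ∀ k, 0 ≤ G k) (hN : ∀ k, 0 ≤ N k) (hW : ∀ k, 0 ≤ W k)
    (hc : ∀ k, 0 ≤ ε k * β k * (α k + δ) - δ * β (k + 1) * ε (k + 1))
    (hstep : ∀ k, δ * β (k + 1) * (G (k + 1) + ε (k + 1) / 2 * (N (k + 1) - n)) + W (k + 1)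
        + 1 / 2 * ‖l (k + 1) - ls‖ ^ 2 ≤
      δ * β k * (G k + ε k / 2 * (N k - n)) + W k + 1 / 2 * ‖l k - ls‖ ^ 2
        - (ε k * β k * (α k + δ) - δ * β (k + 1) * ε (k + 1)) / 2 * (N (k + 1) - n))
    (hx : ∀ k, x k = x (k + 1) - α k • v (k + 1))
    (hl : ∀ k, l (k + 1) = l k + (α k * β k) • (A (x (k + 1) + δ • v (k + 1)) - b)) :
    Tendsto G atTop (𝓝 0) ∧ Tendsto (fun k => A (x k) - b) atTop (𝓝 0) := by
  -- The last summand is not needed for the energy bound; it provides the initial condition of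
  -- `norm_residual_le`.
  set C : ℝ := δ * β 0 * (G 0 + ε 0 / 2 * N 0) + W 0 + 1 / 2 * ‖l 0 - ls‖ ^ 2 +
    ‖(l 0 - ls) - (δ * β 0) • (A (x 0) - b)‖ ^ 2 with hC
  set M : ℕ → ℝ := fun k => C + n / 2 * ∑ j ∈ Finset.range k, β j * (α j * ε j) with hM
  have hαε : ∀ k, 0 ≤ α k * ε k := fun k => mul_nonneg (hα k).le (hε k)
  have hC0 : ‖(l 0 - ls) - (δ * β 0) • (A (x 0) - b)‖ ^ 2 ≤ C := by
    have h1 : 0 ≤ δ * β 0 * (G 0 + ε 0 / 2 * N 0) := by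
      have := hG 0; have := hN 0; have := hε 0; have := hβ 0; positivity
    have := hW 0
    have := sq_nonneg ‖l 0 - ls‖
    linarith
  have hMle : ∀ k, δ * β k * G k + 1 / 2 * ‖l k - ls‖ ^ 2 ≤ M k := by
    intro k
    have h := energy_le_sum (P := fun k => ‖l k - ls‖ ^ 2) hδ hβ hε hN hW hc hstep k
    have := sq_nonneg ‖(l 0 - ls) - (δ * β 0) • (A (x 0) - b)‖
    simp only [hM, hC]
    linarith
  have hMmono : Monotone M := by
    refine monotone_nat_of_le_succ fun k => ?_
    simp only [hM, Finset.sum_range_succ]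
    have : 0 ≤ n / 2 * (β k * (α k * ε k)) := by
      have := hβ k; have := hαε k; positivity
    linarith
  have hMlim : Tendsto (fun k => M k / β k) atTop (𝓝 0) := by
    have h := (hlim.const_div_atTop C).add
      ((tendsto_weighted_sum_div hαε hsum hβ hmono hlim).const_mul (n / 2))
    rw [mul_zero, add_zero] at h
    refine h.congr fun k => ?_
    simp only [hM]; ring
  have hM0 : ∀ k, 0 ≤ M k := fun k => by
    have := hMle k
    have := mul_nonneg (mul_pos hδ (hβ k)).le (hG k)
    have := sq_nonneg ‖l k - ls‖
    linarith
  constructor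
  · have h := hMlim.div_const δ
    rw [zero_div] at h
    refine squeeze_zero hG (fun k => ?_) h
    rw [div_div, le_div_iff₀ (mul_pos (hβ k) hδ)]
    have := hMle k
    have := sq_nonneg ‖l k - ls‖
    linarith
  -- Since α_k v_{k+1} = x_{k+1} - x_k, the dual update is the recursion of `norm_residual_le`, with
  -- a_k ≥ 0 by the growth condition. The resulting bound ‖A x_k - b‖ ≤ 2√(2 M_k) / (δ β_k) tends to
  -- 0 because M_k = o(β_k).
  · have hres := norm_residual_le (p := fun k => l k - ls) (r := fun k => A (x k) - b)
      (c := fun k => δ * β k) (a := fun k => δ * β k + α k * β k - δ * β (k + 1))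
      (R := fun k => √(2 * M k)) (fun k => mul_pos hδ (hβ k)) (fun k => sub_nonneg.2 (hgrowth k))
      ?_ (fun i j hij => Real.sqrt_le_sqrt (by linarith [hMmono hij])) ?_ ?_
    · rw [tendsto_zero_iff_norm_tendsto_zero]
      have h1 : Tendsto (fun k => 2 / δ * √(2 * (M k / β k) * (1 / β k))) atTop (𝓝 0) := by
        have h2 := (((hMlim.const_mul 2).mul (hlim.const_div_atTop 1)).sqrt).const_mul (2 / δ)
        simpa using h2
      refine squeeze_zero (fun k => norm_nonneg _) (fun k => ?_) h1
      have h3 := hres k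
      have hb := hβ k
      rw [norm_smul, Real.norm_of_nonneg (mul_pos hδ hb).le] at h3
      have h4 : 2 * (M k / β k) * (1 / β k) = 2 * M k / β k ^ 2 := by field_simp
      rw [h4, Real.sqrt_div' _ (sq_nonneg _), Real.sqrt_sq hb.le, div_mul_div_comm,
        le_div_iff₀ (mul_pos hδ hb)]
      linarith
    · intro k
      have h1 : A (x k) = A (x (k + 1)) - α k • A (v (k + 1)) := by
        rw [← map_smul, ← map_sub, ← hx k]
      simp only [hl k, h1, map_add, map_smul]
      module
    · intro k
      refine Real.le_sqrt_of_sq_le ?_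
      have := hMle k
      have := mul_nonneg (mul_pos hδ (hβ k)).le (hG k)
      linarith
    · refine Real.le_sqrt_of_sq_le ?_
      have h1 : M 0 = C := by simp [hM]
      have := sq_nonneg ‖(l 0 - ls) - (δ * β 0) • (A (x 0) - b)‖
      simp only [h1]
      linarith

/-! ### Saddle points and approximate solution sets -/

/-- The primal part of a saddle point is an optimal solution with finite value, and the Lagrangian
is minimized by it. -/
theorem IsSaddlePoint.exists_value {f : X → EReal} {A : X →L[ℝ] Z} {b : Z} {μ : ℝ} {xs : X}
    {ls : Z} (hf : IsProperConvexLsc f μ) (h : IsSaddlePoint f A b xs ls) :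
    ∃ m : ℝ, f xs = m ∧ xs ∈ solutionSet f A b ∧
      ∀ x, (m : EReal) ≤ f x + ((inner ℝ ls (A x - b) : ℝ) : EReal) := by
  obtain ⟨h1, h2⟩ := h
  simp only [lagrangian] at h1 h2
  have hfx : f xs ≠ ⊤ := by
    intro htop
    obtain ⟨u, hu⟩ := hf.exists_ne_top
    obtain ⟨r, hr⟩ := exists_coe_eq hf hu
    have h := h2 u
    rw [htop, hr, EReal.top_add_coe, ← EReal.coe_add, top_le_iff] at h
    exact EReal.coe_ne_top _ h
  obtain ⟨m, hm⟩ := exists_coe_eq hf hfx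
  have hA : A xs = b := by
    -- Moving the multiplier along the residual gives ‖A xs - b‖² ≤ 0.
    have h := h1 (ls + (A xs - b))
    rw [hm, ← EReal.coe_add, ← EReal.coe_add, EReal.coe_le_coe_iff, inner_add_left] at h
    rw [← sub_eq_zero, ← real_inner_self_nonpos]
    simpa using h
  have h3 : ∀ x, (m : EReal) ≤ f x + ((inner ℝ ls (A x - b) : ℝ) : EReal) := by
    intro x
    have := h2 x
    rwa [hA, sub_self, inner_zero_right, EReal.coe_zero, add_zero, hm] at this
  refine ⟨m, hm, ⟨hA, fun y hy => ?_⟩, h3⟩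
  have := h3 y
  rwa [hy, sub_self, inner_zero_right, EReal.coe_zero, add_zero, ← hm] at this

/-- Nearly optimal and nearly feasible points. -/
def approxSolutionSet (f : X → EReal) (A : X →L[ℝ] Z) (b : Z) (m : ℝ) (n : ℕ) : Set X :=
  {x | f x ≤ ((m + 1 / ((n : ℝ) + 1) : ℝ) : EReal)} ∩ {x | ‖A x - b‖ ≤ 1 / ((n : ℝ) + 1)}

theorem antitone_approxSolutionSet (f : X → EReal) (A : X →L[ℝ] Z) (b : Z) (m : ℝ) :
    Antitone (approxSolutionSet f A b m) := by
  intro i j hij x hx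
  have h : 1 / ((j : ℝ) + 1) ≤ 1 / ((i : ℝ) + 1) := Nat.one_div_le_one_div hij
  refine ⟨le_trans (show f x ≤ _ from hx.1) ?_, le_trans (show ‖A x - b‖ ≤ _ from hx.2) h⟩
  exact_mod_cast add_le_add_right h m

theorem isClosed_approxSolutionSet {f : X → EReal} {μ : ℝ} (hf : IsProperConvexLsc f μ)
    (A : X →L[ℝ] Z) (b : Z) (m : ℝ) (n : ℕ) : IsClosed (approxSolutionSet f A b m n) :=
  (hf.lsc.isClosed_preimage _).inter
    (isClosed_le ((A.continuous.sub continuous_const).norm) continuous_const)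

theorem convex_approxSolutionSet {f : X → EReal} {μ : ℝ} (hf : IsProperConvexLsc f μ)
    (A : X →L[ℝ] Z) (b : Z) (m : ℝ) (n : ℕ) : Convex ℝ (approxSolutionSet f A b m n) := by
  refine (convex_sublevel hf _).inter ?_
  have h := (convex_closedBall b (1 / ((n : ℝ) + 1))).linear_preimage A.toLinearMap
  convert h using 1
  ext x
  simp [dist_eq_norm]

/-- Identifies the target of `tendsto_minNorm_of_antitone`, and yields closedness and convexity of
the solution set, hence existence and uniqueness of its minimal-norm point. -/
theorem iInter_approxSolutionSet {f : X → EReal} {A : X →L[ℝ] Z} {b : Z} {m : ℝ} {xs : X}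
    (hm : f xs = m) (hxs : xs ∈ solutionSet f A b) :
    ⋂ n, approxSolutionSet f A b m n = solutionSet f A b := by
  ext x
  rw [Set.mem_iInter]
  constructor
  · intro h
    have h1 : f x ≤ m := by
      have hlim : Tendsto (fun n : ℕ => ((m + 1 / ((n : ℝ) + 1) : ℝ) : EReal)) atTop
          (𝓝 ((m + 0 : ℝ) : EReal)) :=
        (continuous_coe_real_ereal.tendsto _).comp
          (tendsto_const_nhds.add tendsto_one_div_add_atTop_nhds_zero_nat)
      rw [add_zero] at hlim
      exact ge_of_tendsto' hlim fun n => (h n).1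
    have h2 : ‖A x - b‖ ≤ 0 :=
      ge_of_tendsto' tendsto_one_div_add_atTop_nhds_zero_nat fun n => (h n).2
    refine ⟨sub_eq_zero.1 (norm_le_zero_iff.1 h2), fun y hy => ?_⟩
    exact (h1.trans hm.ge).trans (hxs.2 y hy)
  · intro h n
    have hn : (0 : ℝ) < 1 / ((n : ℝ) + 1) := Nat.one_div_pos_of_nat
    refine ⟨(h.2 xs hxs.1).trans (hm.le.trans ?_), ?_⟩
    · exact_mod_cast (le_add_of_nonneg_right hn.le : m ≤ m + _)
    · change ‖A x - b‖ ≤ _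
      rw [h.1, sub_self, norm_zero]; exact hn.le

theorem exists_isMinNormElement [CompleteSpace X] {S : Set X} (hne : S.Nonempty)
    (hS : IsClosed S) (hc : Convex ℝ S) :
    ∃ p, IsMinNormElement S p ∧ ∀ q, IsMinNormElement S q → q = p := by
  obtain ⟨p, hp, key⟩ := exists_norm_sub_sq_le hne hS hc
  refine ⟨p, ⟨hp, fun y hy => ?_⟩, fun q hq => ?_⟩
  · refine le_of_sq_le_sq ?_ (norm_nonneg _)
    have := key y hy
    have := sq_nonneg ‖y - p‖
    linarith
  · have h1 := key q hq.1
    have h2 := pow_le_pow_left₀ (norm_nonneg _) (hq.2 p hp) 2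
    have h3 : ‖q - p‖ ^ 2 ≤ 0 := by linarith
    exact sub_eq_zero.1 (norm_eq_zero.1 (pow_eq_zero_iff two_ne_zero |>.1
      (le_antisymm h3 (sq_nonneg _))))

/-! ### Convergence of the iterates -/

/-- Every minimal-norm solution attracts the iterates along each filter on which their norms are
asymptotically at most minimal; this holds along `atTop` if the norms are eventually at least
minimal. -/
theorem IsGenerated.tendsto_of_norm_le [CompleteSpace X] [CompleteSpace Z]
    {f : X → EReal} {A : X →L[ℝ] Z} {b : Z} {μ δ γ : ℝ} {α β ε : ℕ → ℝ}
    {x z zδ : ℕ → X} {lam : ℕ → Z} {xs : X} {ls : Z}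
    (hμ : 0 ≤ μ) (hf : IsProperConvexLsc f μ) (hδ : 0 < δ) (hγ : 0 < γ) (hδγ : 0 ≤ δ * γ - 1)
    (hα : ∀ k, 1 ≤ k → 0 < α k) (hβ : ∀ k, 1 ≤ k → 0 < β k)
    (hβ_mono : ∀ k, 1 ≤ k → β k ≤ β (k + 1)) (hβ_lim : Tendsto β atTop atTop)
    (hβ_growth : ∀ k, 1 ≤ k → δ * β (k + 1) ≤ δ * β k + α k * β k)
    (hε_anti : ∀ k, 1 ≤ k → ε (k + 1) ≤ ε k)
    (hαε : Summable fun k : ℕ => α (k + 1) * ε (k + 1))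
    (hβε : Tendsto (fun k => β k * ε k) atTop atTop)
    (hgen : IsGenerated f A b μ δ γ α β ε x z zδ lam)
    (hsaddle : IsSaddlePoint f A b xs ls) {xbar : X}
    (hbar : IsMinNormElement (solutionSet f A b) xbar) :
    (∀ l ≤ atTop, (∀ r > ‖xbar‖ ^ 2, ∀ᶠ k in l, ‖x k‖ ^ 2 ≤ r) → Tendsto x l (𝓝 xbar)) ∧
      ((∀ᶠ k in atTop, ‖xbar‖ ≤ ‖x k‖) → ∀ r > ‖xbar‖ ^ 2, ∀ᶠ k in atTop, ‖x k‖ ^ 2 ≤ r) := by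
  obtain ⟨m, hm, hxs, hmin⟩ := hsaddle.exists_value hf
  -- Positivity holds at arbitrarily large indices because β_k ε_k → ∞, and monotonicity carries it
  -- back to every k ≥ 1.
  have hε : ∀ k, 1 ≤ k → 0 < ε k := by
    intro k hk
    have hle : ∀ j, k ≤ j → ε j ≤ ε k := by
      intro j hj
      induction j, hj using Nat.le_induction with
      | base => exact le_rfl
      | succ j hj ih => exact (hε_anti j (hk.trans hj)).trans ih
    obtain ⟨j, hj, hkj⟩ := ((hβε.eventually_gt_atTop 0).and (eventually_ge_atTop k)).exists
    exact ((pos_iff_pos_of_mul_pos hj).1 (hβ j (hk.trans hkj))).trans_le (hle j hkj)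
  have hbarA : A xbar = b := hbar.1.1
  have hbarf : f xbar = m :=
    le_antisymm ((hbar.1.2 xs hxs.1).trans hm.le) (hm.ge.trans (hxs.2 xbar hbarA))
  -- optimality conditions
  have hopt := fun k (hk : 1 ≤ k) => exists_subgradient_of_subproblem_minimizer hf (hα k hk)
    (hβ k hk) hγ hδ hμ (hgen.step_x k hk) (hgen.step_z k hk)
    ((hgen.step_lam k hk).trans (by rw [hgen.step_zδ k hk]))
  -- The analysis starts at index 2: `x 1` is an arbitrary starting point where `f` may be infinite,
  -- while `x 2` is the first minimizer.
  have hfin : ∀ k, ∃ F : ℝ, f (x (k + 2)) = F := fun k =>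
    exists_coe_eq hf (hopt (k + 1) (by omega)).1
  choose F hF using hfin
  set v : ℕ → X := fun k => z (k + 2) - γ • x (k + 2) with hv
  have hv' : ∀ k, α (k + 2) • v (k + 1) = x (k + 3) - x (k + 2) := by
    intro k
    have hz := hgen.step_z (k + 2) (by omega)
    have h1 : v (k + 1) = (1 / α (k + 2)) • (x (k + 3) - x (k + 2)) := by
      simp only [hv]
      rw [hz]
      module
    rw [h1, smul_smul, mul_one_div_cancel (hα (k + 2) (by omega)).ne', one_smul]
  have hxv : ∀ k, x (k + 2) = x (k + 3) - α (k + 2) • v (k + 1) := fun k => by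
    rw [hv' k]; abel
  have hlv : ∀ k, lam (k + 3) = lam (k + 2) +
      (α (k + 2) * β (k + 2)) • (A (x (k + 3) + δ • v (k + 1)) - b) := by
    intro k
    rw [hgen.step_lam (k + 2) (by omega), hgen.step_zδ (k + 2) (by omega)]
    congr 4
    simp only [hv]
    module
  have hG : ∀ k, m ≤ F k + inner ℝ ls (A (x (k + 2)) - b) := by
    intro k
    have := hmin (x (k + 2))
    rw [hF k] at this
    exact_mod_cast this
  set G : ℕ → ℝ := fun k => F k + inner ℝ ls (A (x (k + 2)) - b) - m with hGdef
  set W : ℕ → ℝ := fun k => (γ / 2 * ‖x (k + 2) - xbar‖ ^ 2 + inner ℝ (v k) (x (k + 2) - xbar) +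
    δ / 2 * ‖v k‖ ^ 2) + μ * δ * β (k + 2) / 2 * ‖x (k + 2) - xbar‖ ^ 2 with hWdef
  have hG0 : ∀ k, 0 ≤ G k := fun k => sub_nonneg.2 (hG k)
  have hW0 : ∀ k, 0 ≤ W k := fun k => by
    have h1 := quadratic_form_nonneg hδ hδγ (x (k + 2) - xbar) (v k)
    have h2 := hβ (k + 2) (by omega)
    exact add_nonneg h1 (by positivity)
  -- Product of the growth condition on `β` and the monotonicity of `ε`.
  have hc : ∀ k, 0 ≤ ε (k + 2) * β (k + 2) * (α (k + 2) + δ) - δ * β (k + 3) * ε (k + 3) := by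
    intro k
    have h1 := mul_le_mul (hβ_growth (k + 2) (by omega)) (hε_anti (k + 2) (by omega))
      (hε (k + 3) (by omega)).le (by
        have := hβ (k + 2) (by omega); have := hα (k + 2) (by omega); positivity)
    simp only [add_assoc, Nat.reduceAdd] at h1
    linarith
  have hstep' : ∀ k, δ * β (k + 3) * (G (k + 1) + ε (k + 3) / 2 * (‖x (k + 3)‖ ^ 2 - ‖xbar‖ ^ 2))
        + W (k + 1) + 1 / 2 * ‖lam (k + 3) - ls‖ ^ 2 ≤
      δ * β (k + 2) * (G k + ε (k + 2) / 2 * (‖x (k + 2)‖ ^ 2 - ‖xbar‖ ^ 2)) + W k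
        + 1 / 2 * ‖lam (k + 2) - ls‖ ^ 2
        - (ε (k + 2) * β (k + 2) * (α (k + 2) + δ) - δ * β (k + 3) * ε (k + 3)) / 2 *
          (‖x (k + 3)‖ ^ 2 - ‖xbar‖ ^ 2) := by
    intro k
    obtain ⟨-, w, hw, hweq⟩ := hopt (k + 2) (by omega)
    have hs := hf.subgradient_ineq _ w hw
    have h1 := hs xbar
    have h0 := hs (x (k + 2))
    rw [hF (k + 1), hbarf, ← EReal.coe_add, EReal.coe_le_coe_iff, ← add_assoc] at h1
    rw [hF (k + 1), hF k, ← EReal.coe_add, EReal.coe_le_coe_iff, ← add_assoc] at h0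
    have h := energy_step (v₀ := v k) (β' := β (k + 3)) (ε' := ε (k + 3)) (γ := γ) A b
      (hα (k + 2) (by omega)) (hβ (k + 2) (by omega)) (hε (k + 2) (by omega)).le hδ hδγ hμ
      (hβ_growth (k + 2) (by omega)) (hxv k) (hlv k)
      (by rw [← hweq, hv' k]; simp only [hv]; module) hbarA h1 h0 (hG (k + 1))
    simp only [hGdef, hWdef]
    linarith
  have hshift : ∀ {P : ℕ → Prop}, (∀ᶠ k in atTop, P k) ↔ ∀ᶠ k in atTop, P (k + 2) := by
    intro P
    nth_rewrite 1 [← map_add_atTop_eq_nat 2]; rfl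
  have hsum2 : Summable fun k : ℕ => α (k + 2) * ε (k + 2) :=
    (summable_nat_add_iff 1).2 hαε
  constructor
  · intro l hl hnorm
    obtain ⟨hGlim, hAlim⟩ := tendsto_gap_and_residual (α := fun k => α (k + 2))
      (β := fun k => β (k + 2)) (ε := fun k => ε (k + 2)) (x := fun k => x (k + 2)) (v := v)
      (l := fun k => lam (k + 2)) (G := G) (W := W) (N := fun k => ‖x (k + 2)‖ ^ 2) hδ
      (fun k => hα _ (by omega)) (fun k => hβ _ (by omega)) (fun k => (hε _ (by omega)).le)
      (monotone_nat_of_le_succ fun k => hβ_mono (k + 2) (by omega))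
      ((tendsto_add_atTop_iff_nat 2).2 hβ_lim) (fun k => hβ_growth (k + 2) (by omega)) hsum2
      (sq_nonneg ‖xbar‖) hG0 (fun k => sq_nonneg _) hW0 hc hstep' hxv hlv
    have hFlim : Tendsto F atTop (𝓝 m) := by
      have h := (hGlim.sub (tendsto_const_nhds.inner hAlim (𝕜 := ℝ) (x := ls))).const_add m
      rw [inner_zero_right, sub_zero, add_zero] at h
      refine h.congr fun k => ?_
      simp only [hGdef]; ring
    refine tendsto_minNorm_of_antitone (antitone_approxSolutionSet f A b m)
      (isClosed_approxSolutionSet hf A b m) (convex_approxSolutionSet hf A b m)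
      (by rwa [iInter_approxSolutionSet hm hxs]) (fun n => hl (hshift.2 ?_)) hnorm
    have hn : (0 : ℝ) < 1 / ((n : ℝ) + 1) := Nat.one_div_pos_of_nat
    filter_upwards [hFlim.eventually_le_const (lt_add_of_pos_right m hn),
      hAlim.norm.eventually_le_const (by rwa [norm_zero])] with k hk1 hk2
    refine ⟨?_, hk2⟩
    change f (x (k + 2)) ≤ _
    rw [hF k]
    exact_mod_cast hk1
  · intro hge r hr
    exact hshift.2 (eventually_le_of_eventually_ge (α := fun k => α (k + 2))
      (β := fun k => β (k + 2)) (ε := fun k => ε (k + 2)) (G := G) (W := W)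
      (N := fun k => ‖x (k + 2)‖ ^ 2) (P := fun k => ‖lam (k + 2) - ls‖ ^ 2) hδ
      (fun k => hβ _ (by omega)) ((tendsto_add_atTop_iff_nat 2).2 hβε) hG0 hW0
      (fun k => sq_nonneg _) hc hstep'
      ((hshift.1 hge).mono fun k hk => pow_le_pow_left₀ (norm_nonneg _) hk 2) hr)

end PrimalDual

theorem corollary5p2
    {X Z : Type*}
    [NormedAddCommGroup X] [InnerProductSpace ℝ X] [CompleteSpace X]
    [NormedAddCommGroup Z] [InnerProductSpace ℝ Z] [CompleteSpace Z]
    (f : X → EReal) (A : X →L[ℝ] Z) (b : Z)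
    (μ δ γ : ℝ) (α β ε : ℕ → ℝ)
    (x z zδ : ℕ → X) (lam : ℕ → Z) (xs : X) (ls : Z)
    (hμ : 0 ≤ μ) (hf : PrimalDual.IsProperConvexLsc f μ)
    (hδ : 0 < δ) (hγ : 0 < γ) (hδγ : 0 ≤ δ * γ - 1)
    (hα : ∀ k, 1 ≤ k → 0 < α k)
    (hβ : ∀ k, 1 ≤ k → 0 < β k)
    (hβ_mono : ∀ k, 1 ≤ k → β k ≤ β (k + 1))
    (hβ_lim : Tendsto β atTop atTop)
    (hβ_growth : ∀ k, 1 ≤ k → δ * β (k + 1) ≤ δ * β k + α k * β k)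
    (hε_anti : ∀ k, 1 ≤ k → ε (k + 1) ≤ ε k)
    (hαε : Summable fun k : ℕ => α (k + 1) * ε (k + 1))
    (hβε : Tendsto (fun k => β k * ε k) atTop atTop)
    (hgen : PrimalDual.IsGenerated f A b μ δ γ α β ε x z zδ lam)
    (hsaddle : PrimalDual.IsSaddlePoint f A b xs ls) :
    ∃ xbar : X,
      PrimalDual.IsMinNormElement (PrimalDual.solutionSet f A b) xbar ∧
      (∀ y, PrimalDual.IsMinNormElement (PrimalDual.solutionSet f A b) y → y = xbar) ∧
      liminf (fun k => ((‖x k - xbar‖ : ℝ) : EReal)) atTop = 0 ∧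
      ((∃ K, 1 ≤ K ∧
          ((∀ k, K ≤ k → x k ∈ Metric.ball (0 : X) ‖xbar‖) ∨
            (∀ k, K ≤ k → x k ∈ (Metric.ball (0 : X) ‖xbar‖)ᶜ))) →
        Tendsto (fun k => ‖x k - xbar‖) atTop (𝓝 0)) := by
  obtain ⟨m, hm, hxs, -⟩ := hsaddle.exists_value hf
  obtain ⟨xbar, hbar, huniq⟩ := PrimalDual.exists_isMinNormElement ⟨xs, hxs⟩
    (by rw [← PrimalDual.iInter_approxSolutionSet hm hxs]
        exact isClosed_iInter (PrimalDual.isClosed_approxSolutionSet hf A b m))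
    (by rw [← PrimalDual.iInter_approxSolutionSet hm hxs]
        exact convex_iInter (PrimalDual.convex_approxSolutionSet hf A b m))
  obtain ⟨hlim, hout⟩ := hgen.tendsto_of_norm_le hμ hf hδ hγ hδγ hα hβ hβ_mono hβ_lim hβ_growth
    hε_anti hαε hβε hsaddle hbar
  have hge : (∀ᶠ k in atTop, ‖xbar‖ ≤ ‖x k‖) → Tendsto x atTop (𝓝 xbar) := fun h =>
    hlim atTop le_rfl (hout h)
  have hlt : ∀ l ≤ atTop, (∀ᶠ k in l, ‖x k‖ < ‖xbar‖) → Tendsto x l (𝓝 xbar) := fun l hl h =>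
    hlim l hl fun r hr => h.mono fun k hk =>
      (pow_le_pow_left₀ (norm_nonneg _) hk.le 2).trans hr.le
  refine ⟨xbar, hbar, huniq, ?_, ?_⟩
  · have hfreq : ∀ e > 0, ∃ᶠ k in atTop, ‖x k - xbar‖ < e := by
      intro e he
      by_cases h : ∀ᶠ k in atTop, ‖xbar‖ ≤ ‖x k‖
      · refine Eventually.frequently ?_
        filter_upwards [Metric.tendsto_nhds.1 (hge h) e he] with k hk
        rwa [← dist_eq_norm]
      · have hfr : ∃ᶠ k in atTop, ‖x k‖ < ‖xbar‖ := by
          simpa only [not_eventually, not_le] using h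
        -- The restricted filter plays the role of the subsequence of iterates inside the ball.
        have hev := Metric.tendsto_nhds.1 (hlt (atTop ⊓ 𝓟 {k | ‖x k‖ < ‖xbar‖}) inf_le_left
          (mem_inf_of_right (mem_principal_self _))) e he
        rw [eventually_inf_principal] at hev
        refine (hfr.and_eventually hev).mono fun k hk => ?_
        rw [← dist_eq_norm]
        exact hk.2 hk.1
    refine le_antisymm ?_ ?_
    · refine EReal.le_of_forall_lt_iff_le.1 fun e he => ?_
      exact liminf_le_of_frequently_le'
        ((hfreq e (by exact_mod_cast he)).mono fun k hk => by exact_mod_cast hk.le)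
    · exact le_liminf_of_le (by isBoundedDefault)
        (Eventually.of_forall fun k => by exact_mod_cast norm_nonneg _)
  · rintro ⟨K, -, hK⟩
    rw [← tendsto_iff_norm_sub_tendsto_zero]
    rcases hK with hK | hK
    · refine hlt atTop le_rfl ?_
      filter_upwards [eventually_ge_atTop K] with k hk
      simpa using hK k hk
    · refine hge ?_
      filter_upwards [eventually_ge_atTop K] with k hk
      simpa using hK k hk
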